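/- For $\lambda>0$ let $g(\lambda)=\sqrt{\dfrac{\tanh\sqrt\lambda}{\sqrt\lambda}}$. Then for every real $\alpha\in(0,1]$ the function $\lambda\mapsto (g(\lambda))^{2\alpha}$ on $(0,\infty)$ is a (nonnegative) Stieltjes function; that is, it takes values in $[0,\infty)$ and there are constants $a,b\ge 0$ and a (positive) Borel measure $\sigma$ on $(0,\infty)$ with $\int_{(0,\infty)}\frac{d\sigma(t)}{1+t}<\infty$ such that $$(g(\lambda))^{2\alpha}=\frac{a}{\lambda}+b+\int_{(0,\infty)}\frac{1}{\lambda+t}\,d\sigma(t)\qquad\text{for all }\lambda>0.$$ -/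

import Mathlib

open MeasureTheory Set

/-- A function `g : (0, ∞) → [0, ∞)` (given as a function on `ℝ`, of which only the values at
positive arguments matter) is a (nonnegative) Stieltjes function if
`g(x) = a / x + b + ∫_{(0,∞)} 1 / (x + t) dσ(t)` for all `x > 0`, with constants `a, b ≥ 0` and a
(positive) Borel measure `σ` on `(0, ∞)` such that `∫_{(0,∞)} 1 / (1 + t) dσ(t) < ∞`.

The measure `σ` is a Borel measure on `ℝ` of which only the restriction to `(0, ∞)` is used. The
finiteness condition makes `t ↦ 1 / (x + t)` integrable for every `x > 0`, because
`1 / (x + t) ≤ max 1 (1 / x) * (1 / (1 + t))`. -/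
def IsStieltjesFun (g : ℝ → ℝ) : Prop :=
  (∀ x : ℝ, 0 < x → 0 ≤ g x) ∧
  ∃ (a b : ℝ) (σ : Measure ℝ), 0 ≤ a ∧ 0 ≤ b ∧
    IntegrableOn (fun t : ℝ => 1 / (1 + t)) (Ioi 0) σ ∧
    ∀ x : ℝ, 0 < x → g x = a / x + b + ∫ t in Ioi (0 : ℝ), 1 / (x + t) ∂σ

/-- The function `g(x) = √(tanh √x / √x)`, used for `x > 0` only. -/
noncomputable def whithamG (x : ℝ) : ℝ :=
  √(Real.tanh (√x) / √x)

/-! By partial fractions, f(x) = tanh √x / √x is the sum of 2 / (x + (π(2k+1)/2)²) over k ≥ 0, hence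
Stieltjes; this is α = 1. For α < 1, f^α is a positive mixture over s > 0 of f / (1 + s f). For a
finite partial sum, f / (1 + s f) equals ⟨v, (x + T)⁻¹ v⟩ with T ≥ 0 symmetric, so the spectral
theorem makes it Stieltjes (`div_one_add_mul_sum`). Limits and mixtures are taken in the dual form
`IsStieltjesPositive`, which they preserve trivially; the measure is recovered only once, at the end
(`exists_measure`, `isStieltjesFun`). -/

/-! ### Partial fractions of coth and tanh -/

open Filter Topology in
theorem tendsto_sum_pi_mul_coth {y : ℝ} (hy : 0 < y) :
    Tendsto (fun n : ℕ => ∑ k ∈ Finset.range n, 2 * y / (y ^ 2 + (k + 1) ^ 2)) atTop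
      (𝓝 (Real.pi * (Real.cosh (Real.pi * y) / Real.sinh (Real.pi * y)) - 1 / y)) := by
  have hmem : (y * Complex.I : ℂ) ∈ Complex.integerComplement := by
    rw [Complex.mem_integerComplement_iff]
    rintro ⟨n, hn⟩
    have := congrArg Complex.im hn
    simp at this
    exact hy.ne this
  -- Euler's cotangent expansion at z = iy; the factor i turns cot(iπy) into coth(πy).
  have h := ((tendsto_logDeriv_euler_cot_sub hmem).mul_const Complex.I)
  have h2 := (Complex.continuous_re.tendsto _).comp h
  have hy' : (y : ℂ) ≠ 0 := by exact_mod_cast hy.ne'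
  convert h2 using 1
  · funext n
    simp only [Function.comp_apply, Finset.sum_mul, Complex.re_sum]
    refine Finset.sum_congr rfl fun k _ => ?_
    rw [cotTerm_identity hmem]
    have h3 : 2 * (y * Complex.I : ℂ) * (1 / ((y * Complex.I + (k + 1)) * (y * Complex.I - (k + 1))))
        * Complex.I = ((2 * y / (y ^ 2 + (k + 1) ^ 2) : ℝ) : ℂ) := by
      have e : ((y * Complex.I + (k + 1)) * (y * Complex.I - (k + 1)) : ℂ)
          = -((y ^ 2 + (k + 1) ^ 2 : ℝ) : ℂ) := by
        push_cast
        linear_combination (y : ℂ) ^ 2 * Complex.I_sq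
      have e0 : ((y ^ 2 + (k + 1) ^ 2 : ℝ) : ℂ) ≠ 0 := by
        exact_mod_cast (by positivity : (y ^ 2 + (k + 1) ^ 2 : ℝ) ≠ 0)
      rw [e, Complex.ofReal_div]
      push_cast at e0 ⊢
      field_simp
      linear_combination -Complex.I_sq
    rw [h3, Complex.ofReal_re]
  · congr 1
    have h4 : (Real.pi * Complex.cot (Real.pi * (y * Complex.I)) - 1 / (y * Complex.I)) * Complex.I
        = ((Real.pi * (Real.cosh (Real.pi * y) / Real.sinh (Real.pi * y)) - 1 / y : ℝ) : ℂ) := by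
      have hs : Complex.sinh (Real.pi * y) ≠ 0 := by
        rw [← Complex.ofReal_mul, ← Complex.ofReal_sinh]
        exact_mod_cast (Real.sinh_pos_iff.2 (by positivity)).ne'
      rw [Complex.cot, ← mul_assoc, Complex.cos_mul_I, Complex.sin_mul_I]
      push_cast
      field_simp
    rw [h4, Complex.ofReal_re]

-- From tanh z = 2 coth 2z - coth z: in the coth sums over 2n and n terms the even poles cancel,
-- leaving the odd ones.
open Filter Topology in
theorem tendsto_sum_tanh_sqrt_div {x : ℝ} (hx : 0 < x) :
    Tendsto (fun n : ℕ => ∑ k ∈ Finset.range n, 2 / (x + (Real.pi * (2 * k + 1) / 2) ^ 2)) atTop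
      (𝓝 (Real.tanh √x / √x)) := by
  have hπ := Real.pi_pos
  obtain ⟨y, hy, hxy⟩ : ∃ y : ℝ, 0 < y ∧ √x = Real.pi * y :=
    ⟨√x / Real.pi, by positivity, by field_simp⟩
  have hx2 : x = Real.pi ^ 2 * y ^ 2 := by rw [← mul_pow, ← hxy, Real.sq_sqrt hx.le]
  have h1 := (tendsto_sum_pi_mul_coth (y := 2 * y) (by positivity)).comp
    (tendsto_id.const_mul_atTop' (r := 2) two_pos)
  have h := ((h1.const_mul 2).sub (tendsto_sum_pi_mul_coth hy)).mul_const (1 / (Real.pi ^ 2 * y))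
  convert h using 1
  · funext n
    simp only [Function.comp_apply, id]
    induction n with
    | zero => simp
    | succ n ih =>
      rw [Finset.sum_range_succ, ih, show 2 * (n + 1) = 2 * n + 1 + 1 by ring, Finset.sum_range_succ,
        Finset.sum_range_succ, Finset.sum_range_succ, hx2]
      push_cast
      field_simp
      ring
  · congr 1
    have hs := (Real.sinh_pos_iff.2 (by positivity : 0 < Real.pi * y)).ne'
    have hc := (Real.cosh_pos (Real.pi * y)).ne'
    rw [hxy, Real.tanh_eq_sinh_div_cosh, show Real.pi * (2 * y) = 2 * (Real.pi * y) by ring,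
      Real.cosh_two_mul, Real.sinh_two_mul]
    field_simp
    ring

/-! ### Stieltjes functions by duality -/

/-- Positivity of `g` against every finite signed combination of point evaluations that is
nonnegative on all the kernels `x ↦ 1 / (1 - u + u x)`, `u ∈ [0, 1]`. By duality this is
equivalent to being a Stieltjes function. -/
def IsStieltjesPositive (g : ℝ → ℝ) : Prop :=
  ∀ (s : Finset (Ioi (0 : ℝ))) (w : Ioi (0 : ℝ) → ℝ),
    (∀ u ∈ Icc (0 : ℝ) 1, 0 ≤ ∑ x ∈ s, w x * (1 / (1 - u + u * x))) →
      0 ≤ ∑ x ∈ s, w x * g x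

theorem one_sub_add_mul_pos {x u : ℝ} (hx : 0 < x) (hu : u ∈ Icc (0 : ℝ) 1) :
    0 < 1 - u + u * x := by
  rcases hu.1.eq_or_lt with rfl | h
  · simp
  · have := mul_pos h hx
    linarith [hu.2]

open CompactlySupportedContinuousMap in
theorem exists_measure_of_nonneg {X : Type*} [TopologicalSpace X] [T2Space X] [CompactSpace X]
    [MeasurableSpace X] [BorelSpace X] (L : C(X, ℝ) →ₗ[ℝ] ℝ) (hL : ∀ f, 0 ≤ f → 0 ≤ L f) :
    ∃ μ : Measure X, IsFiniteMeasure μ ∧ ∀ f : C(X, ℝ), ∫ x, f x ∂μ = L f := by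
  let Λ : CompactlySupportedContinuousMap X ℝ →ₚ[ℝ] ℝ := PositiveLinearMap.mk₀
    { toFun := fun f => L f.toContinuousMap
      map_add' := fun f g => L.map_add _ _
      map_smul' := fun r f => L.map_smul _ _ } fun f hf => hL _ hf
  refine ⟨RealRMK.rieszMeasure Λ, inferInstance, fun f => ?_⟩
  exact RealRMK.integral_rieszMeasure Λ (continuousMapEquiv f)

namespace IsStieltjesPositive

theorem congr {f g : ℝ → ℝ} (hf : IsStieltjesPositive f) (h : ∀ x, 0 < x → g x = f x) :
    IsStieltjesPositive g := by
  intro s w hw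
  have := hf s w hw
  rwa [Finset.sum_congr rfl fun x _ => by rw [← h x x.2]] at this

theorem one_div_add {a : ℝ} (ha : 0 ≤ a) : IsStieltjesPositive fun x => 1 / (x + a) := by
  intro s w hw
  have h1 : 0 < 1 + a := by linarith
  -- At u = 1 / (1 + a) the kernel is (1 + a) / (x + a).
  have h := hw (1 / (1 + a)) ⟨by positivity, by rw [div_le_one h1]; linarith⟩
  have e : ∑ x ∈ s, w x * (1 / ((x : ℝ) + a)) =
      (1 / (1 + a)) * ∑ x ∈ s, w x * (1 / (1 - 1 / (1 + a) + 1 / (1 + a) * x)) := by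
    rw [Finset.mul_sum]
    refine Finset.sum_congr rfl fun x _ => ?_
    have hx : (0 : ℝ) < x := x.2
    rw [show 1 - 1 / (1 + a) + 1 / (1 + a) * (x : ℝ) = (x + a) / (1 + a) by field_simp; ring]
    field_simp
  rw [e]
  positivity

theorem const_mul {f : ℝ → ℝ} (hf : IsStieltjesPositive f) {c : ℝ} (hc : 0 ≤ c) :
    IsStieltjesPositive fun x => c * f x := by
  intro s w hw
  have e : ∑ x ∈ s, w x * (c * f x) = c * ∑ x ∈ s, w x * f x := by
    rw [Finset.mul_sum]
    exact Finset.sum_congr rfl fun x _ => by ring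
  rw [e]
  exact mul_nonneg hc (hf s w hw)

theorem sum {ι : Type*} {t : Finset ι} {f : ι → ℝ → ℝ}
    (hf : ∀ i ∈ t, IsStieltjesPositive (f i)) : IsStieltjesPositive fun x => ∑ i ∈ t, f i x := by
  intro s w hw
  simp_rw [Finset.mul_sum]
  rw [Finset.sum_comm]
  exact Finset.sum_nonneg fun i hi => hf i hi s w hw

open Filter Topology in
theorem of_tendsto {ι : Type*} {l : Filter ι} [l.NeBot] {f : ι → ℝ → ℝ} {g : ℝ → ℝ}
    (hf : ∀ i, IsStieltjesPositive (f i))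
    (h : ∀ x, 0 < x → Tendsto (fun i => f i x) l (𝓝 (g x))) : IsStieltjesPositive g := by
  intro s w hw
  exact ge_of_tendsto' (tendsto_finsetSum s fun x _ => (h x x.2).const_mul (w x))
    fun i => hf i s w hw

theorem setIntegral {ι : Type*} [MeasurableSpace ι] {μ : Measure ι} {t : Set ι}
    (ht : MeasurableSet t) {f : ι → ℝ → ℝ} (hf : ∀ i ∈ t, IsStieltjesPositive (f i))
    (hint : ∀ x, 0 < x → IntegrableOn (fun i => f i x) t μ) :
    IsStieltjesPositive fun x => ∫ i in t, f i x ∂μ := by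
  intro s w hw
  simp_rw [← integral_const_mul]
  rw [← integral_finsetSum s fun x _ => (hint x x.2).const_mul (w x)]
  exact setIntegral_nonneg ht fun i hi => hf i hi s w hw

open RealInnerProductSpace in
/-- A rank-one perturbation of a diagonal operator turns the resolvent function `f` into
`f / (1 + s f)`. -/
theorem div_one_add_mul_sum {ι : Type*} [Fintype ι] {c a : ι → ℝ} (hc : ∀ i, 0 ≤ c i)
    (ha : ∀ i, 0 ≤ a i) {s : ℝ} (hs : 0 ≤ s) :
    IsStieltjesPositive fun x => (∑ i, c i / (x + a i)) / (1 + s * ∑ i, c i / (x + a i)) := by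
  obtain ⟨v, hv⟩ : ∃ v : EuclideanSpace ℝ ι, ∀ i, v i = √(c i) :=
    ⟨WithLp.toLp 2 fun i => √(c i), fun _ => rfl⟩
  obtain ⟨T, hTi⟩ : ∃ T : EuclideanSpace ℝ ι →ₗ[ℝ] EuclideanSpace ℝ ι,
      ∀ y i, T y i = a i * y i + s * ⟪v, y⟫ * v i :=
    ⟨{  toFun := fun y => WithLp.toLp 2 fun i => a i * y i + s * ⟪v, y⟫ * v i
        map_add' := fun y z => by
          ext i
          simp [inner_add_right]
          ring
        map_smul' := fun r y => by
          ext i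
          simp [inner_smul_right]
          ring }, fun _ _ => rfl⟩
  have hT : ∀ y z, ⟪T y, z⟫ = ∑ i, a i * y i * z i + s * ⟪v, y⟫ * ⟪v, z⟫ := by
    intro y z
    rw [PiLp.inner_apply, PiLp.inner_apply v z, Finset.mul_sum, ← Finset.sum_add_distrib]
    refine Finset.sum_congr rfl fun i _ => ?_
    rw [hTi]
    simp only [RCLike.inner_apply, conj_trivial]
    ring
  have hsymm : T.IsSymmetric := by
    intro y z
    rw [real_inner_comm (T z) y, hT, hT]
    congr 1
    · exact Finset.sum_congr rfl fun i _ => by ring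
    · ring
  have hpos : T.IsPositive := by
    refine ⟨hsymm, fun y => ?_⟩
    rw [RCLike.re_to_real, hT]
    refine add_nonneg (Finset.sum_nonneg fun i _ => ?_) ?_
    · rw [mul_assoc]
      exact mul_nonneg (ha i) (mul_self_nonneg _)
    · rw [mul_assoc]
      exact mul_nonneg hs (mul_self_nonneg _)
  have hn : Module.finrank ℝ (EuclideanSpace ℝ ι) = Fintype.card ι := finrank_euclideanSpace
  let e := hsymm.eigenvectorBasis hn
  let l := hsymm.eigenvalues hn
  have hl : ∀ j, 0 ≤ l j := hpos.nonneg_eigenvalues hn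
  refine (IsStieltjesPositive.sum (t := Finset.univ) (f := fun j x => ⟪e j, v⟫ ^ 2 * (1 / (x + l j)))
    fun j _ => (one_div_add (hl j)).const_mul (sq_nonneg _)).congr fun x hx => ?_
  set f := ∑ i, c i / (x + a i) with hf
  have hf0 : 0 ≤ f := Finset.sum_nonneg fun i _ => div_nonneg (hc i) (add_nonneg hx.le (ha i))
  have h1 : 0 < 1 + s * f := by positivity
  -- Sherman–Morrison: this y is (x + T)⁻¹ v.
  obtain ⟨y, hyi⟩ : ∃ y : EuclideanSpace ℝ ι, ∀ i,
      y i = (1 / (1 + s * f)) * (√(c i) / (x + a i)) :=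
    ⟨WithLp.toLp 2 fun i => (1 / (1 + s * f)) * (√(c i) / (x + a i)), fun _ => rfl⟩
  have hvy : ⟪v, y⟫ = f / (1 + s * f) := by
    rw [hf, Finset.sum_div, ← hf, PiLp.inner_apply]
    refine Finset.sum_congr rfl fun i _ => ?_
    have := Real.mul_self_sqrt (hc i)
    have hxa : x + a i ≠ 0 := (add_pos_of_pos_of_nonneg hx (ha i)).ne'
    simp only [hv, hyi, RCLike.inner_apply, conj_trivial]
    field_simp
    linarith
  have hy : T y + x • y = v := by
    ext i
    have hxa : x + a i ≠ 0 := (add_pos_of_pos_of_nonneg hx (ha i)).ne'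
    rw [PiLp.add_apply, PiLp.smul_apply, smul_eq_mul, hTi, hvy, hv, hyi]
    field_simp
    ring
  have hj : ∀ j, ⟪e j, v⟫ = (x + l j) * ⟪e j, y⟫ := by
    intro j
    have h2 : T (e j) = l j • e j := by
      exact hsymm.apply_eigenvectorBasis hn j
    rw [← hy, inner_add_right, ← hsymm, h2, inner_smul_left, inner_smul_right]
    simp
    ring
  rw [← hvy, ← e.sum_inner_mul_inner]
  refine Finset.sum_congr rfl fun j _ => ?_
  have hxl : x + l j ≠ 0 := (add_pos_of_pos_of_nonneg hx (hl j)).ne'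
  rw [real_inner_comm, hj j]
  field_simp

/-- Sending the kernel of x to g x defines a positive functional on the span of the kernels. M.
Riesz extension carries it to C([0, 1]), where Riesz–Markov gives μ. -/
theorem exists_measure {g : ℝ → ℝ} (hg : IsStieltjesPositive g) :
    ∃ μ : Measure (Icc (0 : ℝ) 1), IsFiniteMeasure μ ∧
      ∀ x, 0 < x → g x = ∫ u : Icc (0 : ℝ) 1, 1 / (1 - (u : ℝ) + u * x) ∂μ := by
  let k : Ioi (0 : ℝ) → C(Icc (0 : ℝ) 1, ℝ) := fun x =>
    ⟨fun u => 1 / (1 - (u : ℝ) + u * x),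
      continuous_const.div (by fun_prop) fun u => (one_sub_add_mul_pos x.2 u.2).ne'⟩
  let Φ : (Ioi (0 : ℝ) →₀ ℝ) →ₗ[ℝ] C(Icc (0 : ℝ) 1, ℝ) := Finsupp.linearCombination ℝ k
  let G : (Ioi (0 : ℝ) →₀ ℝ) →ₗ[ℝ] ℝ := Finsupp.linearCombination ℝ fun x => g x
  have hpos : ∀ w, 0 ≤ Φ w → 0 ≤ G w := by
    intro w hw
    have h := hg w.support w fun u hu => by
      have := hw ⟨u, hu⟩
      simpa [Φ, Finsupp.linearCombination_apply, Finsupp.sum, k, ContinuousMap.sum_apply] using this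
    simpa [G, Finsupp.linearCombination_apply, Finsupp.sum] using h
  have hker : LinearMap.ker Φ ≤ LinearMap.ker G := by
    intro w hw
    rw [LinearMap.mem_ker] at hw ⊢
    refine le_antisymm ?_ (hpos w hw.ge)
    simpa using hpos (-w) (by simp [hw])
  let F : C(Icc (0 : ℝ) 1, ℝ) →ₗ.[ℝ] ℝ :=
    ⟨LinearMap.range Φ, (Submodule.liftQ _ G hker).comp Φ.quotKerEquivRange.symm.toLinearMap⟩
  have hF : ∀ w (h : Φ w ∈ F.domain), F ⟨Φ w, h⟩ = G w := by
    intro w h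
    change Submodule.liftQ _ G hker (Φ.quotKerEquivRange.symm ⟨Φ w, h⟩) = G w
    rw [show (⟨Φ w, h⟩ : LinearMap.range Φ) = Φ.quotKerEquivRange (Submodule.Quotient.mk w) from rfl,
      LinearEquiv.symm_apply_apply]
    rfl
  obtain ⟨L, hLF, hL⟩ := riesz_extension (PointedCone.positive ℝ C(Icc (0 : ℝ) 1, ℝ)) F (by
      rintro ⟨_, w, rfl⟩ hw
      refine (hpos w ?_).trans_eq (hF w ⟨w, rfl⟩).symm
      simpa using hw) (by
      intro y
      -- The kernel at x = 1 is constantly 1, so the span contains the constants.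
      refine ⟨⟨Φ (Finsupp.single ⟨1, mem_Ioi.2 one_pos⟩ ‖y‖), _, rfl⟩, ?_⟩
      rw [PointedCone.mem_positive]
      intro u
      have := y.norm_coe_le_norm u
      have h2 := neg_abs_le (y u)
      rw [Real.norm_eq_abs] at this
      simp [Φ, k]
      linarith)
  obtain ⟨μ, hμ, h⟩ := exists_measure_of_nonneg L fun f hf => hL f (by simpa using hf)
  refine ⟨μ, hμ, fun x hx => ?_⟩
  have e := h (k ⟨x, hx⟩)
  have hk : k ⟨x, hx⟩ = Φ (Finsupp.single ⟨x, hx⟩ 1) := by simp [Φ]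
  have e' : L (Φ (Finsupp.single ⟨x, hx⟩ 1)) = G (Finsupp.single ⟨x, hx⟩ 1) :=
    (hLF ⟨_, _, rfl⟩).trans (hF _ ⟨_, rfl⟩)
  rw [← hk] at e'
  rw [e'] at e
  simpa [G, k] using e.symm

theorem nonneg {g : ℝ → ℝ} (hg : IsStieltjesPositive g) {x : ℝ} (hx : 0 < x) : 0 ≤ g x := by
  simpa using hg {⟨x, hx⟩} 1 fun u hu => by
    simpa using (one_sub_add_mul_pos hx hu).le

/-- Substitute t = (1 - u) / u on (0, 1), with density 1 / u. The atoms at u = 1 and u = 0 give a /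
x and b. -/
theorem isStieltjesFun {g : ℝ → ℝ} (hg : IsStieltjesPositive g) : IsStieltjesFun g := by
  obtain ⟨μ', hμ', hrep'⟩ := hg.exists_measure
  let μ : Measure ℝ := μ'.map Subtype.val
  have hμI : ∀ᵐ u ∂μ, u ∈ Icc (0 : ℝ) 1 :=
    (ae_map_iff measurable_subtype_coe.aemeasurable measurableSet_Icc).2 (.of_forall fun u => u.2)
  have hrep : ∀ x, 0 < x → g x = ∫ u, 1 / (1 - u + u * x) ∂μ := by
    intro x hx
    rw [hrep' x hx, (MeasurableEmbedding.subtype_coe measurableSet_Icc).integral_map]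
  have hmeas : ∀ x : ℝ, Measurable fun u : ℝ => 1 / (1 - u + u * x) := fun x => by fun_prop
  have hint : ∀ x, 0 < x → Integrable (fun u => 1 / (1 - u + u * x)) μ := by
    intro x hx
    refine Integrable.of_bound (hmeas x).aestronglyMeasurable (1 / min 1 x) ?_
    filter_upwards [hμI] with u hu
    have hm : 0 < min 1 x := lt_min one_pos hx
    rw [Real.norm_of_nonneg (one_div_nonneg.2 (one_sub_add_mul_pos hx hu).le)]
    refine one_div_le_one_div_of_le hm ?_
    nlinarith [min_le_left 1 x, min_le_right 1 x, hu.1, hu.2]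
  let φ : ℝ → ℝ := fun u => (1 - u) / u
  have hφ : Measurable φ := by fun_prop
  let ν : Measure ℝ := (μ.restrict (Ioo 0 1)).withDensity fun u => ENNReal.ofReal (1 / u)
  have hd : Measurable fun u : ℝ => ENNReal.ofReal (1 / u) := by fun_prop
  have hpre : ∀ᵐ u ∂ν, φ u ∈ Ioi (0 : ℝ) := by
    refine (withDensity_absolutelyContinuous _ _).ae_le ?_
    filter_upwards [ae_restrict_mem measurableSet_Ioo] with u hu
    exact div_pos (sub_pos.2 hu.2) hu.1
  have hres : (ν.map φ).restrict (Ioi 0) = ν.map φ :=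
    Measure.restrict_eq_self_of_ae_mem ((ae_map_iff hφ.aemeasurable measurableSet_Ioi).2 hpre)
  have hker : ∀ x, 0 < x → ∀ u ∈ Ioo (0 : ℝ) 1,
      (ENNReal.ofReal (1 / u)).toReal • (1 / (x + φ u)) = 1 / (1 - u + u * x) := by
    intro x hx u hu
    have hu0 := hu.1
    have := one_sub_add_mul_pos hx (Ioo_subset_Icc_self hu)
    have h2 : x + (1 - u) / u = (1 - u + u * x) / u := by field_simp; ring
    rw [ENNReal.toReal_ofReal (by positivity), smul_eq_mul]
    simp only [φ]
    rw [h2]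
    field_simp
  have hσm : ∀ x : ℝ, Measurable fun t : ℝ => 1 / (x + t) := fun x => by fun_prop
  have hσint : ∀ x, 0 < x → IntegrableOn (fun t => 1 / (x + t)) (Ioi 0) (ν.map φ) := by
    intro x hx
    rw [IntegrableOn, hres, integrable_map_measure (hσm x).aestronglyMeasurable hφ.aemeasurable,
      integrable_withDensity_iff_integrable_smul' hd (.of_forall fun _ => ENNReal.ofReal_lt_top)]
    exact ((hint x hx).integrableOn (s := Ioo 0 1)).congr_fun
      (fun u hu => (hker x hx u hu).symm) measurableSet_Ioo
  have hσ : ∀ x, 0 < x →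
      ∫ t in Ioi (0 : ℝ), 1 / (x + t) ∂(ν.map φ) = ∫ u in Ioo (0 : ℝ) 1, 1 / (1 - u + u * x) ∂μ := by
    intro x hx
    rw [hres, integral_map hφ.aemeasurable (hσm x).aestronglyMeasurable,
      integral_withDensity_eq_integral_toReal_smul hd (.of_forall fun _ => ENNReal.ofReal_lt_top)]
    exact setIntegral_congr_fun measurableSet_Ioo (hker x hx)
  refine ⟨fun x hx => hg.nonneg hx, μ.real {1}, μ.real {0}, ν.map φ, measureReal_nonneg,
    measureReal_nonneg, hσint 1 one_pos, fun x hx => ?_⟩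
  have hμr : μ.restrict (Icc 0 1) = μ := Measure.restrict_eq_self_of_ae_mem hμI
  have hint' := fun s : Set ℝ => (hint x hx).integrableOn (s := s)
  rw [hσ x hx, hrep x hx]
  conv_lhs => rw [← hμr]
  rw [← Ioc_insert_left zero_le_one, insert_eq,
    setIntegral_union (by simp) measurableSet_Ioc (hint' _) (hint' _),
    ← Ioo_insert_right zero_lt_one, insert_eq,
    setIntegral_union (by simp) measurableSet_Ioo (hint' _) (hint' _)]
  simp only [integral_singleton, smul_eq_mul]
  norm_num
  ring

/-- If every `f / (1 + s f)` with `s > 0` is Stieltjes, so are the powers `f ^ p`, `0 < p < 1`. -/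
theorem rpow {f : ℝ → ℝ} (hf0 : ∀ x, 0 < x → 0 ≤ f x)
    (hf : ∀ s, 0 < s → IsStieltjesPositive fun x => f x / (1 + s * f x)) {p : ℝ}
    (hp : p ∈ Ioo (0 : ℝ) 1) : IsStieltjesPositive fun x => f x ^ p := by
  have h : IsStieltjesPositive fun x => ∫ t in Ioi (0 : ℝ), Real.rpowIntegrand₀₁ p t (f x) := by
    refine IsStieltjesPositive.setIntegral measurableSet_Ioi (fun t ht => ?_) fun x hx =>
      Real.integrableOn_rpowIntegrand₀₁_Ioi hp (hf0 x hx)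
    have ht' : (0 : ℝ) < t := ht
    -- The integrand is t^(p-1) f / (t + f), so s = 1 / t.
    refine ((hf t⁻¹ (inv_pos.2 ht')).const_mul
      (div_nonneg (Real.rpow_nonneg ht'.le (p - 1)) ht'.le)).congr fun x hx => ?_
    have := hf0 x hx
    rw [Real.rpowIntegrand₀₁_eq_pow_div hp ht'.le this]
    field_simp
  exact (h.const_mul (inv_nonneg.2 (Real.integral_rpowIntegrand₀₁_one_pos hp).le)).congr
    fun x hx => Real.rpow_eq_const_mul_integral hp (hf0 x hx)

end IsStieltjesPositive

/-! ### Application to tanh √x / √x -/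

theorem tanh_sqrt_div_sqrt_nonneg (x : ℝ) : 0 ≤ Real.tanh √x / √x := by
  rw [Real.tanh_eq_sinh_div_cosh]
  have := Real.sinh_nonneg_iff.2 (Real.sqrt_nonneg x)
  have := Real.cosh_pos √x
  positivity

theorem isStieltjesPositive_tanh_sqrt_div_one_add {s : ℝ} (hs : 0 ≤ s) :
    IsStieltjesPositive fun x => Real.tanh √x / √x / (1 + s * (Real.tanh √x / √x)) := by
  refine IsStieltjesPositive.of_tendsto (l := Filter.atTop) (fun n : ℕ =>
    IsStieltjesPositive.div_one_add_mul_sum (ι := Fin n) (c := fun _ => 2)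
      (a := fun k => (Real.pi * (2 * k + 1) / 2) ^ 2) (fun _ => zero_le_two)
      (fun _ => sq_nonneg _) hs) fun x hx => ?_
  have h := tendsto_sum_tanh_sqrt_div hx
  simp_rw [Finset.sum_range] at h
  have h0 := mul_nonneg hs (tanh_sqrt_div_sqrt_nonneg x)
  exact h.div ((h.const_mul s).const_add 1) (by positivity)

theorem whithamG_rpow_two_mul (x α : ℝ) : whithamG x ^ (2 * α) = (Real.tanh √x / √x) ^ α := by
  rw [whithamG, Real.rpow_mul (Real.sqrt_nonneg _), Real.rpow_two,
    Real.sq_sqrt (tanh_sqrt_div_sqrt_nonneg x)]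

theorem proposition2p10 (α : ℝ) (hα : α ∈ Set.Ioc (0 : ℝ) 1) :
    IsStieltjesFun (fun x : ℝ => whithamG x ^ (2 * α)) := by
  refine IsStieltjesPositive.isStieltjesFun ?_
  simp_rw [whithamG_rpow_two_mul]
  rcases hα.2.lt_or_eq with h | rfl
  · exact .rpow (fun x _ => tanh_sqrt_div_sqrt_nonneg x)
      (fun s hs => isStieltjesPositive_tanh_sqrt_div_one_add hs.le) ⟨hα.1, h⟩
  -- The integral formula for powers needs α < 1; α = 1 is the case s = 0.
  · simpa using isStieltjesPositive_tanh_sqrt_div_one_add le_rfl
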